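/- **Theorem.** $\mathrm{add}(\mathcal N)=\min\{\mathrm{non}(\mathcal R),\mathfrak b\}$, where the notation is as follows. - $\mathcal N$ is the ideal of null subsets of $2^\omega$ for the coin-tossing (Lebesgue) product measure, and $\mathrm{add}(\mathcal N)$ is the least cardinality of a family $\mathcal A\subseteq\mathcal N$ with $\bigcup\mathcal A\notin\mathcal N$. - For distinct $x,y\in 2^\omega$ let $h(x,y)=\min\{n\in\omega : x(n)\neq y(n)\}$, and for $Y\subseteq 2^\omega$ let $H(Y)=\{h(x,y) : x,y\in Y,\ x\neq y\}$. The Raisonnier filter $\mathcal F_X$ of $X\subseteq 2^\omega$ is the filter of all $a\subseteq\omega$ for which there are sets $Y_n\subseteq 2^\omega$ ($n<\omega$) with $X\subseteq\bigcup_{n<\omega}Y_n$ and $\bigcup_{n<\omega}H(Y_n)\subseteq a$. - A filter $\mathcal F$ on $\omega$ (the trivial filter $\mathscr P(\omega)$ being allowed) is rapid if for every increasing $f\in\omega^\omega$ there is $a\in\mathcal F$ such that $|a\cap\{0,\dots,f(n)-1\}|\le n$ for all $n\in\omega$. - $\mathcal R=\{X\subseteq 2^\omega : \mathcal F_X\text{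 is rapid}\}$ is the Raisonnier ideal, and $\mathrm{non}(\mathcal R)$ is the least cardinality of a set $X\subseteq 2^\omega$ with $X\notin\mathcal R$. - $\mathfrak b$ is the bounding number, i.e. the least cardinality of a family $F\subseteq\omega^\omega$ for which there is no $g\in\omega^\omega$ such that every $f\in F$ satisfies $f(n)\le g(n)$ for all but finitely many $n$. -/

import Mathlib

namespace Raisonnier

open Cardinal

/-- The set `H(Y)` of splitting points of `Y ⊆ 2^ω`: the numbers `h(x, y)`, for distinct
`x, y ∈ Y`, where `h(x, y)` is the least `n` with `x n ≠ y n`. -/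
def splittingPoints (Y : Set (ℕ → Bool)) : Set ℕ :=
  {k | ∃ x ∈ Y, ∃ y ∈ Y, x ≠ y ∧ PiNat.firstDiff x y = k}

theorem splittingPoints_mono {Y Z : Set (ℕ → Bool)} (h : Y ⊆ Z) :
    splittingPoints Y ⊆ splittingPoints Z := by
  rintro k ⟨x, hx, y, hy, hxy, rfl⟩
  exact ⟨x, h hx, y, h hy, hxy, rfl⟩

/-- The Raisonnier filter of `X ⊆ 2^ω`: the sets `a ⊆ ω` for which `X` has a countable cover
`{Y n | n < ω}` with `⋃ n, H(Y n) ⊆ a`. It may be the trivial filter `⊥`, which contains every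
subset of `ω`. -/
def raisonnierFilter (X : Set (ℕ → Bool)) : Filter ℕ where
  sets := {a | ∃ Y : ℕ → Set (ℕ → Bool), X ⊆ (⋃ n, Y n) ∧ (⋃ n, splittingPoints (Y n)) ⊆ a}
  univ_sets := ⟨fun _ => X, fun _ hx => Set.mem_iUnion.2 ⟨0, hx⟩, Set.subset_univ _⟩
  sets_of_superset := by
    rintro a b ⟨Y, hX, ha⟩ hab
    exact ⟨Y, hX, ha.trans hab⟩
  inter_sets := by
    rintro a b ⟨Y, hY, ha⟩ ⟨Z, hZ, hb⟩
    refine ⟨fun n => Y n.unpair.1 ∩ Z n.unpair.2, ?_, ?_⟩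
    · intro x hx
      obtain ⟨i, hi⟩ := Set.mem_iUnion.1 (hY hx)
      obtain ⟨j, hj⟩ := Set.mem_iUnion.1 (hZ hx)
      refine Set.mem_iUnion.2 ⟨Nat.pair i j, ?_⟩
      rw [Nat.unpair_pair]
      exact ⟨hi, hj⟩
    · refine Set.iUnion_subset fun n => Set.subset_inter ?_ ?_
      · exact (splittingPoints_mono Set.inter_subset_left).trans
          ((Set.subset_iUnion (fun i => splittingPoints (Y i)) n.unpair.1).trans ha)
      · exact (splittingPoints_mono Set.inter_subset_right).trans
          ((Set.subset_iUnion (fun i => splittingPoints (Z i)) n.unpair.2).trans hb)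

/-- A filter on `ω` is rapid if for every increasing `f : ω → ω` it contains a set `a` with
`|a ∩ f(n)| ≤ n` for all `n`, where `f(n) = {0, …, f(n) - 1}`. The trivial filter is rapid. -/
def IsRapid (F : Filter ℕ) : Prop :=
  ∀ f : ℕ → ℕ, Monotone f → ∃ a ∈ F, ∀ n, (a ∩ Set.Iio (f n)).ncard ≤ n

/-- The Raisonnier ideal: the sets `X ⊆ 2^ω` whose Raisonnier filter is rapid. -/
def raisonnierIdeal : Set (Set (ℕ → Bool)) :=
  {X | IsRapid (raisonnierFilter X)}

/-- The coin-tossing (Lebesgue) measure on `2^ω`: the product of countably many copies of the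
uniform probability measure on the two-point space. -/
noncomputable def cantorMeasure : MeasureTheory.Measure (ℕ → Bool) :=
  MeasureTheory.Measure.infinitePi fun _ : ℕ => (PMF.uniformOfFintype Bool).toMeasure

/-- The ideal of Lebesgue null subsets of `2^ω`. -/
def nullIdeal : Set (Set (ℕ → Bool)) :=
  {N | cantorMeasure N = 0}

/-- `add(I)`: the least cardinality of a family of members of `I` whose union is not in `I`. -/
noncomputable def additivity {α : Type} (I : Set (Set α)) : Cardinal.{0} :=
  sInf {κ | ∃ A : Set (Set α), A ⊆ I ∧ ⋃₀ A ∉ I ∧ #A = κ}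

/-- `non(I)`: the least cardinality of a set not in `I`. -/
noncomputable def uniformity {α : Type} (I : Set (Set α)) : Cardinal.{0} :=
  sInf {κ | ∃ X : Set α, X ∉ I ∧ #X = κ}

/-- The bounding number: the least cardinality of a family of functions `ω → ω` that is not
eventually dominated by a single function. -/
noncomputable def boundingNumber : Cardinal.{0} :=
  sInf {κ | ∃ F : Set (ℕ → ℕ),
    (¬ ∃ g : ℕ → ℕ, ∀ f ∈ F, ∀ᶠ n in Filter.atTop, f n ≤ g n) ∧ #F = κ}

end Raisonnier

namespace Raisonnier

open Cardinal Filter MeasureTheory TopologicalSpace ProbabilityTheory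
open scoped ENNReal

/-! Both sides are compared with localization by slaloms of width `(n + 1) * 2 ^ n`, in the spirit
of Bartoszyński's characterization of the additivity of the null ideal.

If `#F` is below the minimum, then `F` has a common eventual bound and its graphs have a rapid
Raisonnier filter. A set in that filter with at most `n` points below `e n` leaves each piece of the
cover at most `2 ^ n` traces below `e n`, hence at most `2 ^ n` bounded values at `n`
(`localized_of_bounded`). Localizing codes of clopen covers then makes a union of null sets null, by
Borel–Cantelli (`measure_sUnion_eq_zero_of_localized`).

Conversely, below `additivity nullIdeal` every family is localized (`localized_of_lt_additivity`): a
compact set avoids the null sets attached to its members, and independence bounds the number of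
possible values. Localized families are bounded, and localizing initial segments leaves few
splitting points, so the Raisonnier filter is rapid (`mem_raisonnierIdeal_of_localized`). -/

/-- The width of the slaloms used throughout. -/
def width (n : ℕ) : ℕ := (n + 1) * 2 ^ n

/-- A family of functions `ω → ω` is localized if a single slalom, whose `n`-th entry has at most
`(n + 1) * 2 ^ n` elements, eventually captures each of its members. -/
def Localized (F : Set (ℕ → ℕ)) : Prop :=
  ∃ S : ℕ → Finset ℕ, (∀ n, (S n).card ≤ width n) ∧ ∀ f ∈ F, ∀ᶠ n in atTop, f n ∈ S n

theorem Localized.exists_bound {F : Set (ℕ → ℕ)} (hF : Localized F) :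
    ∃ g : ℕ → ℕ, ∀ f ∈ F, ∀ᶠ n in atTop, f n ≤ g n := by
  obtain ⟨S, -, hS⟩ := hF
  exact ⟨fun n => (S n).sup id, fun f hf => (hS f hf).mono fun n hn => Finset.le_sup (f := id) hn⟩

/-- A countable cover yields a localization, once each piece takes at most `2 ^ n` values at `n`
that lie below a common bound. -/
theorem localized_of_countable_cover {F : Set (ℕ → ℕ)} (P : ℕ → Set (ℕ → ℕ)) (hP : F ⊆ ⋃ m, P m)
    (V : ℕ → ℕ → Finset ℕ) (hV : ∀ m n, (V m n).card ≤ 2 ^ n)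
    (hPV : ∀ m, ∀ f ∈ F, f ∈ P m → ∀ᶠ n in atTop, f n ∈ V m n) : Localized F := by
  -- At `n` only the pieces `0, …, n` contribute; a function in piece `m` loses nothing but the
  -- values at `n < m`.
  refine ⟨fun n => (Finset.range (n + 1)).biUnion fun m => V m n, fun n => ?_, fun f hf => ?_⟩
  · refine (Finset.card_biUnion_le_card_mul _ _ (2 ^ n) fun m _ => hV m n).trans ?_
    rw [Finset.card_range, width]
  · obtain ⟨m, hm⟩ := Set.mem_iUnion.1 (hP hf)
    filter_upwards [hPV m f hf hm, eventually_ge_atTop m] with n hn hmn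
    exact Finset.mem_biUnion.2 ⟨m, Finset.mem_range.2 (by omega), hn⟩

/-! ### Finite traces -/

/-- If the values of `v` on `s` are determined by subsets of a finite set `a`, there are at most
`2 ^ |a|` of them. -/
theorem exists_finset_card_le_two_pow {α : Type*} (s : Set α) (v : α → ℕ) (a : Finset ℕ)
    (T : α → Finset ℕ) (hT : ∀ x ∈ s, T x ⊆ a) (hv : ∀ x ∈ s, ∀ y ∈ s, T x = T y → v x = v y) :
    ∃ V : Finset ℕ, V.card ≤ 2 ^ a.card ∧ ∀ x ∈ s, v x ∈ V := by
  classical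
  obtain rfl | ⟨x₀, hx₀⟩ := s.eq_empty_or_nonempty
  · exact ⟨∅, by simp, by simp⟩
  have : Nonempty α := ⟨x₀⟩
  refine ⟨a.powerset.image fun t => v (Function.invFunOn T s t),
    Finset.card_image_le.trans (Finset.card_powerset a).le, fun x hx => ?_⟩
  have hex : ∃ y ∈ s, T y = T x := ⟨x, hx, rfl⟩
  refine Finset.mem_image.2 ⟨T x, Finset.mem_powerset.2 (hT x hx), ?_⟩
  exact hv _ (Function.invFunOn_mem hex) _ hx (Function.invFunOn_eq hex)

/-- Two points of `Y` that agree at the splitting points of `Y` below `e` agree below `e`. -/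
theorem eq_of_eq_on_splittingPoints {Y : Set (ℕ → Bool)} {a : Set ℕ} (ha : splittingPoints Y ⊆ a)
    {e : ℕ} {x y : ℕ → Bool} (hx : x ∈ Y) (hy : y ∈ Y) (h : ∀ i ∈ a, i < e → x i = y i) :
    ∀ i < e, x i = y i := by
  intro i hi
  by_contra hne
  have hxy : x ≠ y := fun h => hne (congrFun h i)
  have hle : PiNat.firstDiff x y ≤ i := by
    by_contra hlt
    exact hne (PiNat.apply_eq_of_lt_firstDiff (not_le.1 hlt))
  exact PiNat.apply_firstDiff_ne hxy (h _ (ha ⟨x, hx, y, hy, hxy, rfl⟩) (hle.trans_lt hi))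

/-! ### The indicator of the graph of a function -/

/-- The characteristic function of the graph of `f`, as a point of `2^ω`. -/
def graphIndicator (f : ℕ → ℕ) (i : ℕ) : Bool := decide (f i.unpair.1 = i.unpair.2)

theorem graphIndicator_pair (f : ℕ → ℕ) (n j : ℕ) :
    graphIndicator f (Nat.pair n j) = decide (f n = j) := by
  simp [graphIndicator]

/-- A bounded family of functions is localized if the set of graphs is in the Raisonnier ideal. -/
theorem localized_of_bounded {F : Set (ℕ → ℕ)}
    (hb : ∃ g : ℕ → ℕ, ∀ f ∈ F, ∀ᶠ n in atTop, f n ≤ g n)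
    (hR : graphIndicator '' F ∈ raisonnierIdeal) : Localized F := by
  classical
  obtain ⟨g, hg⟩ := hb
  -- Below `e n` lie the codes of all `(n, j)` with `j ≤ g n`; summing over `i ≤ n` makes `e`
  -- monotone.
  let e : ℕ → ℕ := fun n =>
    ∑ i ∈ Finset.range (n + 1), ∑ j ∈ Finset.range (g i + 1), (Nat.pair i j + 1)
  have he : Monotone e := fun m n hmn =>
    Finset.sum_le_sum_of_subset (Finset.range_mono (Nat.succ_le_succ hmn))
  have hpair : ∀ n j, j ≤ g n → Nat.pair n j < e n := by
    intro n j hj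
    have h1 : Nat.pair n j + 1 ≤ ∑ j ∈ Finset.range (g n + 1), (Nat.pair n j + 1) :=
      Finset.single_le_sum (f := fun j => Nat.pair n j + 1) (fun _ _ => Nat.zero_le _)
        (Finset.mem_range.2 (Nat.lt_succ_of_le hj))
    have h2 : ∑ j ∈ Finset.range (g n + 1), (Nat.pair n j + 1) ≤ e n :=
      Finset.single_le_sum (f := fun i => ∑ j ∈ Finset.range (g i + 1), (Nat.pair i j + 1))
        (fun _ _ => Nat.zero_le _) (Finset.mem_range.2 (Nat.lt_succ_self n))
    omega
  obtain ⟨a, ⟨Y, hXY, hYa⟩, ha⟩ := hR e he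
  have hval : ∀ m n, ∃ V : Finset ℕ, V.card ≤ 2 ^ n ∧
      ∀ f, graphIndicator f ∈ Y m → f n ≤ g n → f n ∈ V := by
    intro m n
    have hfin : (a ∩ Set.Iio (e n)).Finite := (Set.finite_Iio _).inter_of_right _
    obtain ⟨V, hV, hfV⟩ := exists_finset_card_le_two_pow
      {f | graphIndicator f ∈ Y m ∧ f n ≤ g n} (fun f => f n) hfin.toFinset
      (fun f => hfin.toFinset.filter fun i => graphIndicator f i = true)
      (fun _ _ => Finset.filter_subset _ _) (by
        rintro f ⟨hf, hfn⟩ f' ⟨hf', -⟩ hT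
        have hagree := eq_of_eq_on_splittingPoints ((Set.subset_iUnion _ m).trans hYa)
          (e := e n) hf hf' (by
            intro i hia hie
            have := Finset.ext_iff.1 hT i
            simp only [Finset.mem_filter, Set.Finite.mem_toFinset, Set.mem_inter_iff, hia,
              Set.mem_Iio, hie, true_and] at this
            exact Bool.eq_iff_iff.2 this) _ (hpair n _ hfn)
        rw [graphIndicator_pair, graphIndicator_pair] at hagree
        simpa [eq_comm] using hagree)
    refine ⟨V, hV.trans (Nat.pow_le_pow_right two_pos ?_), fun f h1 h2 => hfV f ⟨h1, h2⟩⟩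
    rw [← Set.ncard_eq_toFinset_card _ hfin]
    exact ha n
  choose V hV hfV using hval
  refine localized_of_countable_cover (fun m => graphIndicator ⁻¹' Y m) (fun f hf => ?_) V hV
    fun m f hf hfm => (hg f hf).mono fun n hn => hfV m n f hfm hn
  obtain ⟨m, hm⟩ := Set.mem_iUnion.1 (hXY ⟨f, hf, rfl⟩)
  exact Set.mem_iUnion.2 ⟨m, hm⟩

/-! ### Families smaller than the cardinals. -/

theorem exists_bound_of_lt_boundingNumber {F : Set (ℕ → ℕ)} (hF : #F < boundingNumber) :
    ∃ g : ℕ → ℕ, ∀ f ∈ F, ∀ᶠ n in atTop, f n ≤ g n := by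
  by_contra h
  exact hF.not_ge (csInf_le' ⟨F, h, rfl⟩)

theorem mem_of_lt_uniformity {α : Type} {I : Set (Set α)} {X : Set α} (hX : #X < uniformity I) :
    X ∈ I := by
  by_contra h
  exact hX.not_ge (csInf_le' ⟨X, h, rfl⟩)

theorem sUnion_mem_of_lt_additivity {α : Type} {I A : Set (Set α)} (hA : A ⊆ I)
    (h : #A < additivity I) : ⋃₀ A ∈ I := by
  by_contra hU
  exact h.not_ge (csInf_le' ⟨A, hA, hU, rfl⟩)

theorem localized_of_lt_min {F : Set (ℕ → ℕ)}
    (hF : #F < min (uniformity raisonnierIdeal) boundingNumber) : Localized F :=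
  localized_of_bounded (exists_bound_of_lt_boundingNumber (hF.trans_le (min_le_right _ _)))
    (mem_of_lt_uniformity (mk_image_le.trans_lt (hF.trans_le (min_le_left _ _))))

/-! ### Localization yields membership in the Raisonnier ideal -/

/-- A code of the first `n` values of `x`. -/
def initialCode (n : ℕ) (x : ℕ → Bool) : ℕ := Encodable.encode ((List.range n).map x)

/-- A point of `2^ω` with the given code of its initial segment. -/
def codePoint (c i : ℕ) : Bool := ((Encodable.decode (α := List Bool) c).getD []).getD i false

theorem codePoint_initialCode {n i : ℕ} (hi : i < n) (x : ℕ → Bool) :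
    codePoint (initialCode n x) i = x i := by
  simp [codePoint, initialCode, hi]

theorem firstDiff_eq_of_eq_below {x y x' y' : ℕ → Bool} {n : ℕ} (hx : ∀ i < n, x' i = x i)
    (hy : ∀ i < n, y' i = y i) (hxy : x ≠ y) (h : PiNat.firstDiff x y < n) :
    PiNat.firstDiff x' y' = PiNat.firstDiff x y := by
  have hne : x' (PiNat.firstDiff x y) ≠ y' (PiNat.firstDiff x y) := by
    rw [hx _ h, hy _ h]
    exact PiNat.apply_firstDiff_ne hxy
  have hne' : x' ≠ y' := fun h => hne (congrFun h _)
  have hle : PiNat.firstDiff x' y' ≤ PiNat.firstDiff x y := by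
    by_contra hlt
    exact hne (PiNat.apply_eq_of_lt_firstDiff (not_le.1 hlt))
  refine hle.antisymm ?_
  by_contra hlt
  apply PiNat.apply_firstDiff_ne hne'
  rw [hx _ (hle.trans_lt h), hy _ (hle.trans_lt h)]
  exact PiNat.apply_eq_of_lt_firstDiff (not_le.1 hlt)

/-- `X` is in the Raisonnier ideal as soon as all families of initial segments of its points are
localized. -/
theorem mem_raisonnierIdeal_of_localized {X : Set (ℕ → Bool)}
    (hX : ∀ N : ℕ → ℕ, Localized ((fun x k => initialCode (N k) x) '' X)) :
    X ∈ raisonnierIdeal := by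
  classical
  intro f hf
  -- `v k` bounds the number of points that `a` will have below `N k`: each pair of codes in `S (j +
  -- 1)` gives at most one splitting point. Since `f (v (k + 1)) ≤ N k`, this suffices for all `n`
  -- in `[v k, v (k + 1))`; the summand `k` makes `N` unbounded.
  let v : ℕ → ℕ := fun k => ∑ j ∈ Finset.range k, width (j + 1) * width (j + 1)
  have hvs : ∀ k, v (k + 1) = v k + width (k + 1) * width (k + 1) := fun k =>
    Finset.sum_range_succ _ _
  have hv : StrictMono v := strictMono_nat_of_lt_succ fun k => by
    have : 0 < width (k + 1) := by unfold width; positivity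
    rw [hvs]
    have := Nat.mul_pos this this
    omega
  let N : ℕ → ℕ := fun k => f (v (k + 1)) + k
  have hN : Monotone N := fun j k h =>
    Nat.add_le_add (hf (hv.monotone (Nat.succ_le_succ h))) h
  obtain ⟨S, hS, hXS⟩ := hX N
  let D : ℕ → Finset ℕ := fun k =>
    (S k ×ˢ S k).image fun p => PiNat.firstDiff (codePoint p.1) (codePoint p.2)
  have hD : ∀ k, (D k).card ≤ width k * width k := fun k =>
    Finset.card_image_le.trans (by rw [Finset.card_product]; exact Nat.mul_le_mul (hS k) (hS k))
  -- A splitting point in `[N k, N (k + 1))` is only visible in codes of length `N (k + 1)`, hence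
  -- the index `k + 1`.
  let a : Set ℕ := {i | ∃ k, N k ≤ i ∧ i < N (k + 1) ∧ i ∈ D (k + 1)}
  have hcard : ∀ k, (a ∩ Set.Iio (N k)).ncard ≤ v k := by
    intro k
    have hsub : a ∩ Set.Iio (N k) ⊆ ((Finset.range k).biUnion fun j => D (j + 1) : Finset ℕ) := by
      rintro i ⟨⟨j, hj, -, hij⟩, hi⟩
      refine Finset.mem_coe.2 (Finset.mem_biUnion.2 ⟨j, Finset.mem_range.2 ?_, hij⟩)
      by_contra hkj
      exact absurd (hN (not_lt.1 hkj)) (not_le.2 (hj.trans_lt hi))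
    refine (Set.ncard_le_ncard hsub (Finset.finite_toSet _)).trans ?_
    rw [Set.ncard_coe_finset]
    exact Finset.card_biUnion_le.trans (Finset.sum_le_sum fun j _ => hD (j + 1))
  have hblock : ∀ m i, N m ≤ i → ∃ k, m ≤ k ∧ N k ≤ i ∧ i < N (k + 1) := by
    intro m i hm
    have hP : ∃ k, i < N k := ⟨i + 1, by simp only [N]; omega⟩
    have h1 := Nat.find_spec hP
    have hlt : m < Nat.find hP := by
      by_contra h
      exact absurd (hN (not_lt.1 h)) (not_le.2 (hm.trans_lt h1))
    refine ⟨Nat.find hP - 1, by omega, not_lt.1 (Nat.find_min hP (by omega)), ?_⟩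
    rwa [Nat.sub_add_cancel (by omega)]
  -- A piece fixes both the stage `m` from which `S` captures and the code at `m`. The common code
  -- excludes splitting below `N m`, where `S` gives no control.
  refine ⟨a, ⟨fun p => {x | (∀ k ≥ p.unpair.1, initialCode (N k) x ∈ S k) ∧
    initialCode (N p.unpair.1) x = p.unpair.2}, fun x hx => ?_, ?_⟩, fun n => ?_⟩
  · obtain ⟨m, hm⟩ := eventually_atTop.1 (hXS _ ⟨x, hx, rfl⟩)
    refine Set.mem_iUnion.2 ⟨Nat.pair m (initialCode (N m) x), ?_⟩
    simpa using hm
  · refine Set.iUnion_subset fun p => ?_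
    rintro i ⟨x, ⟨hx, hxm⟩, y, ⟨hy, hym⟩, hxy, rfl⟩
    have hi : N p.unpair.1 ≤ PiNat.firstDiff x y := by
      by_contra hlt
      refine PiNat.apply_firstDiff_ne hxy ?_
      rw [← codePoint_initialCode (not_le.1 hlt) x, hxm, ← hym,
        codePoint_initialCode (not_le.1 hlt)]
    obtain ⟨k, hmk, hki, hik⟩ := hblock _ _ hi
    refine ⟨k, hki, hik, Finset.mem_image.2 ⟨(initialCode (N (k + 1)) x, initialCode (N (k + 1)) y),
      Finset.mem_product.2 ⟨hx _ (by omega), hy _ (by omega)⟩, ?_⟩⟩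
    exact firstDiff_eq_of_eq_below (fun i hi => codePoint_initialCode hi x)
      (fun i hi => codePoint_initialCode hi y) hxy hik
  · have hP : ∃ k, n < v k := ⟨n + 1, hv.id_le (n + 1)⟩
    have hpos : 0 < Nat.find hP := by
      by_contra h
      have h1 := Nat.find_spec hP
      rw [Nat.eq_zero_of_not_pos h] at h1
      simp [v] at h1
    obtain ⟨k, hk⟩ : ∃ k, Nat.find hP = k + 1 := ⟨Nat.find hP - 1, by omega⟩
    have h1 : n < v (k + 1) := hk ▸ Nat.find_spec hP
    have h2 : v k ≤ n := not_lt.1 (Nat.find_min hP (by omega))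
    have h3 : f n ≤ N k := (hf h1.le).trans (Nat.le_add_right _ _)
    refine (Set.ncard_le_ncard (Set.inter_subset_inter_right _ (Set.Iio_subset_Iio h3))
      ((Set.finite_Iio _).inter_of_right _)).trans ((hcard k).trans h2)

/-! ### The Raisonnier ideal is proper -/

/-- By Baire, some piece of any countable cover is dense in a cylinder of some length `N`, so all
numbers from `N` on are its splitting points. The interval `[N, 2 * N + 1)` has `N + 1` elements,
one too many for rapidity. -/
theorem univ_notMem_raisonnierIdeal : Set.univ ∉ raisonnierIdeal := by
  intro hR
  obtain ⟨a, ⟨Y, hY, hYa⟩, ha⟩ := hR (fun n => 2 * n + 1) fun m n h => by dsimp only; omega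
  obtain ⟨n, x, hx⟩ := nonempty_interior_of_iUnion_of_closed (f := fun n => closure (Y n))
    (fun n => isClosed_closure) (Set.univ_subset_iff.1 (hY.trans
      (Set.iUnion_mono fun n => subset_closure)))
  have hmeet : ∀ z ∈ interior (closure (Y n)), ∀ i, ∃ y ∈ Y n, ∀ j < i, y j = z j := by
    intro z hz i
    obtain ⟨y, hyz, hy⟩ := mem_closure_iff.1 (interior_subset hz) (PiNat.cylinder z i)
      (PiNat.isOpen_cylinder _ z i) (PiNat.self_mem_cylinder z i)
    exact ⟨y, hy, fun j hj => hyz j hj⟩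
  obtain ⟨N, hN⟩ : ∃ N, PiNat.cylinder x N ⊆ interior (closure (Y n)) := by
    obtain ⟨t, ⟨z, N, rfl⟩, hxt, ht⟩ := (PiNat.isTopologicalBasis_cylinders
      (fun _ => Bool)).exists_subset_of_mem_open hx isOpen_interior
    exact ⟨N, (PiNat.mem_cylinder_iff_eq.1 hxt).symm ▸ ht⟩
  have hlarge : Set.Ico N (2 * N + 1) ⊆ a ∩ Set.Iio (2 * N + 1) := by
    rintro i ⟨hi, hi'⟩
    refine ⟨hYa (Set.mem_iUnion.2 ⟨n, ?_⟩), hi'⟩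
    obtain ⟨y, hy, hyx⟩ := hmeet x hx (i + 1)
    obtain ⟨z, hz, hzx⟩ := hmeet (Function.update x i (!x i)) (hN fun j hj => by
      rw [Function.update_of_ne (by omega)]) (i + 1)
    have hne : y i ≠ z i := by
      rw [hyx i (Nat.lt_succ_self i), hzx i (Nat.lt_succ_self i), Function.update_self]
      simp
    have hyz : y ≠ z := fun h => hne (congrFun h i)
    refine ⟨y, hy, z, hz, hyz, le_antisymm ?_ ?_⟩
    · by_contra h
      exact hne (PiNat.apply_eq_of_lt_firstDiff (not_le.1 h))
    · by_contra h
      refine PiNat.apply_firstDiff_ne hyz ?_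
      rw [hyx _ (by omega), hzx _ (by omega), Function.update_of_ne (by omega)]
  have h1 := (Set.ncard_le_ncard hlarge ((Set.finite_Iio _).inter_of_right _)).trans (ha N)
  rw [← Finset.coe_Ico, Set.ncard_coe_finset, Nat.card_Ico] at h1
  omega

/-- As `sInf ∅ = 0` for cardinals, lower bounds for the infimum need a witness. -/
theorem uniformity_witnesses_nonempty :
    {κ | ∃ X : Set (ℕ → Bool), X ∉ raisonnierIdeal ∧ #X = κ}.Nonempty :=
  ⟨_, _, univ_notMem_raisonnierIdeal, rfl⟩

theorem boundingNumber_witnesses_nonempty :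
    {κ | ∃ F : Set (ℕ → ℕ), (¬ ∃ g : ℕ → ℕ, ∀ f ∈ F, ∀ᶠ n in atTop, f n ≤ g n) ∧
      #F = κ}.Nonempty := by
  refine ⟨_, Set.univ, ?_, rfl⟩
  rintro ⟨g, hg⟩
  obtain ⟨n, hn⟩ := (hg (fun n => g n + 1) trivial).exists
  omega

/-! ### The coin-tossing measure and the clopen algebra. -/

instance : IsProbabilityMeasure cantorMeasure := by
  unfold cantorMeasure
  infer_instance

/-- This allows sequences of clopen sets to be coded by functions `ω → ω`. -/
instance : Countable (Clopens (ℕ → Bool)) :=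
  Clopens.countable_iff_secondCountable.2 inferInstance

theorem eq_zero_of_forall_le_inv_two_pow {c : ℝ≥0∞} (h : ∀ k : ℕ, c ≤ 2⁻¹ ^ k) : c = 0 :=
  le_antisymm (ge_of_tendsto' (ENNReal.tendsto_pow_atTop_nhds_zero_of_lt_one (by simp)) h)
    zero_le

/-! ### Covers of null sets by clopen sets -/

/-- Disjointness is what makes the measures of the pieces add up to that of `U`. -/
theorem exists_disjoint_clopens_of_isOpen {U : Set (ℕ → Bool)} (hU : IsOpen U) :
    ∃ D : ℕ → Clopens (ℕ → Bool),
      Pairwise (Function.onFun Disjoint fun i => (D i : Set (ℕ → Bool))) ∧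
        ⋃ i, (D i : Set (ℕ → Bool)) = U := by
  classical
  obtain ⟨e, he⟩ := exists_surjective_nat (Clopens (ℕ → Bool))
  let E : ℕ → Set (ℕ → Bool) := fun i => if (e i : Set (ℕ → Bool)) ⊆ U then e i else ∅
  have hE : ∀ i, IsClopen (E i) := fun i => by
    by_cases h : (e i : Set (ℕ → Bool)) ⊆ U
    · simpa only [E, if_pos h] using (e i).isClopen
    · simpa only [E, if_neg h] using isClopen_empty
  have hD : ∀ i, IsClopen (disjointed E i) := fun i =>
    disjointedRec (fun t j ht => ht.diff (hE j)) (hE i)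
  refine ⟨fun i => ⟨disjointed E i, hD i⟩, disjoint_disjointed E, ?_⟩
  change ⋃ i, disjointed E i = U
  rw [iUnion_disjointed]
  apply subset_antisymm
  · refine Set.iUnion_subset fun i => ?_
    by_cases h : (e i : Set (ℕ → Bool)) ⊆ U
    · simpa only [E, if_pos h] using h
    · simp only [E, if_neg h, Set.empty_subset]
  · intro x hx
    obtain ⟨V, hV, hxV, hVU⟩ := isTopologicalBasis_isClopen.exists_subset_of_mem_open hx hU
    obtain ⟨i, hi⟩ := he ⟨V, hV⟩
    have hi' : (e i : Set (ℕ → Bool)) = V := by rw [hi]; rfl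
    exact Set.mem_iUnion.2 ⟨i, by simpa only [E, hi', if_pos hVU] using hxV⟩

/-- Open supersets of measure below `2⁻¹ ^ k` are cut into disjoint clopen pieces, of total measure
at most `2`. A point of `N` is in a piece for each `k`, and `k ≤ Nat.pair k i` makes the indices
unbounded. -/
theorem exists_clopens_tsum_ne_top {N : Set (ℕ → Bool)} (hN : cantorMeasure N = 0) :
    ∃ Q : ℕ → Clopens (ℕ → Bool), ∑' p, cantorMeasure (Q p) ≠ ∞ ∧
      ∀ x ∈ N, ∃ᶠ p in atTop, x ∈ Q p := by
  have hU : ∀ k : ℕ, ∃ U ⊇ N, IsOpen U ∧ cantorMeasure U < 2⁻¹ ^ k := fun k =>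
    N.exists_isOpen_lt_of_lt _ (by rw [hN]; exact ENNReal.pow_pos (by simp) k)
  choose U hNU hUo hUm using hU
  choose D hDd hDU using fun k => exists_disjoint_clopens_of_isOpen (hUo k)
  refine ⟨fun p => D p.unpair.1 p.unpair.2, ?_, fun x hx => ?_⟩
  · have hsum : ∑' p : ℕ, cantorMeasure (D p.unpair.1 p.unpair.2) =
        ∑' k, ∑' i, cantorMeasure (D k i) := by
      rw [← ENNReal.tsum_prod, ← Nat.pairEquiv.symm.tsum_eq]
      rfl
    have hle : ∑' k, ∑' i, cantorMeasure (D k i) ≤ ∑' k : ℕ, (2⁻¹ : ℝ≥0∞) ^ k := by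
      refine ENNReal.tsum_le_tsum fun k => ?_
      rw [← measure_iUnion (hDd k) fun i => (D k i).isClopen.isOpen.measurableSet, hDU]
      exact (hUm k).le
    rw [hsum]
    refine (hle.trans_lt ?_).ne
    rw [ENNReal.tsum_geometric, ENNReal.one_sub_inv_two, inv_inv]
    exact ENNReal.ofNat_lt_top
  · refine frequently_atTop.2 fun m => ?_
    obtain ⟨i, hi⟩ := Set.mem_iUnion.1 ((hDU m).symm ▸ hNU m hx)
    exact ⟨Nat.pair m i, Nat.left_le_pair m i, by simpa using hi⟩

/-- A null set is contained in the upper limit of a sequence of clopen sets of arbitrarily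
quickly decreasing measure. -/
theorem exists_clopens_measure_le {N : Set (ℕ → Bool)} (hN : cantorMeasure N = 0)
    {ε : ℕ → ℝ≥0∞} (hε : ∀ k, 0 < ε k) :
    ∃ C : ℕ → Clopens (ℕ → Bool), (∀ k, cantorMeasure (C k) ≤ ε k) ∧
      ∀ x ∈ N, ∃ᶠ k in atTop, x ∈ C k := by
  obtain ⟨Q, hQ, hNQ⟩ := exists_clopens_tsum_ne_top hN
  -- Tails of the convergent series tend to `0`, so consecutive blocks `[φ k, φ (k + 1))` of the
  -- sequence can be merged into one clopen set of measure at most `ε k`.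
  obtain ⟨φ, hφ, hφε⟩ := extraction_forall_of_eventually
    (P := fun k n => ∑' p, cantorMeasure (Q (p + n)) ≤ ε k) fun k =>
      (ENNReal.tendsto_sum_nat_add _ hQ).eventually_le_const (hε k)
  have hC : ∀ k, IsClopen (⋃ p ∈ Finset.Ico (φ k) (φ (k + 1)), (Q p : Set (ℕ → Bool))) := fun k =>
    isClopen_biUnion_finset fun p _ => (Q p).isClopen
  refine ⟨fun k => ⟨_, hC k⟩, fun k => ?_, fun x hx => ?_⟩
  · refine (measure_biUnion_finset_le _ _).trans (le_trans ?_ (hφε k))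
    rw [Finset.sum_Ico_eq_sum_range]
    simp_rw [add_comm (φ k)]
    exact ENNReal.sum_le_tsum _
  · refine frequently_atTop.2 fun m => ?_
    obtain ⟨p, hp, hxp⟩ := frequently_atTop.1 (hNQ x hx) (φ m)
    have hP : ∃ k, p < φ k := ⟨p + 1, hφ.id_le (p + 1)⟩
    have h1 := Nat.find_spec hP
    have hlt : m < Nat.find hP := by
      by_contra h
      exact absurd (hφ.monotone (not_lt.1 h)) (not_le.2 (hp.trans_lt h1))
    refine ⟨Nat.find hP - 1, by omega, Set.mem_biUnion (x := p) ?_ hxp⟩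
    refine Finset.mem_coe.2 (Finset.mem_Ico.2 ⟨not_lt.1 (Nat.find_min hP (by omega)), ?_⟩)
    rwa [Nat.sub_add_cancel (by omega)]

/-- One slalom captures the coded clopen covers of all members of `A`. Codes of sets larger than `ε
k` are discarded, and the factor `(width k)⁻¹` in `ε k` keeps the remaining union below `2⁻¹ ^ k`,
so Borel–Cantelli applies. -/
theorem measure_sUnion_eq_zero_of_localized {A : Set (Set (ℕ → Bool))} (hA : A ⊆ nullIdeal)
    (hloc : ∀ F : Set (ℕ → ℕ), #F ≤ #A → Localized F) : ⋃₀ A ∈ nullIdeal := by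
  classical
  let ε : ℕ → ℝ≥0∞ := fun k => 2⁻¹ ^ k * (width k : ℝ≥0∞)⁻¹
  have hε : ∀ k, 0 < ε k := fun k =>
    ENNReal.mul_pos (ENNReal.pow_pos (by simp) k).ne'
      (ENNReal.inv_ne_zero.2 (ENNReal.natCast_ne_top _))
  choose C hC hAC using fun N : A => exists_clopens_measure_le (hA N.2) hε
  obtain ⟨e, he⟩ := exists_surjective_nat (Clopens (ℕ → Bool))
  obtain ⟨r, hr⟩ := he.hasRightInverse
  obtain ⟨S, hS, hAS⟩ := hloc (Set.range fun (N : A) k => r (C N k)) mk_range_le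
  let D : ℕ → Set (ℕ → Bool) := fun k =>
    ⋃ c ∈ (S k).filter fun c => cantorMeasure (e c) ≤ ε k, (e c : Set (ℕ → Bool))
  have hw : ∀ k, (width k : ℝ≥0∞) ≠ 0 := fun k => by
    rw [Nat.cast_ne_zero]
    unfold width
    positivity
  have hD : ∀ k, cantorMeasure (D k) ≤ 2⁻¹ ^ k := by
    intro k
    calc cantorMeasure (D k)
        ≤ ∑ c ∈ (S k).filter fun c => cantorMeasure (e c) ≤ ε k, cantorMeasure (e c) :=
          measure_biUnion_finset_le _ _
      _ ≤ ((S k).filter fun c => cantorMeasure (e c) ≤ ε k).card • ε k :=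
          Finset.sum_le_card_nsmul _ _ _ fun c hc => (Finset.mem_filter.1 hc).2
      _ ≤ (width k : ℝ≥0∞) * ε k := by
          rw [nsmul_eq_mul]
          gcongr
          exact (Finset.card_filter_le _ _).trans (hS k)
      _ = 2⁻¹ ^ k := by
          simp only [ε]
          rw [mul_left_comm, ENNReal.mul_inv_cancel (hw k) (ENNReal.natCast_ne_top _), mul_one]
  have hlim : cantorMeasure {x | ∃ᶠ k in atTop, x ∈ D k} = 0 := by
    refine measure_setOfPred_frequently_eq_zero (p := fun k x => x ∈ D k)
      ((ENNReal.tsum_le_tsum hD).trans_lt ?_).ne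
    rw [ENNReal.tsum_geometric, ENNReal.one_sub_inv_two, inv_inv]
    exact ENNReal.ofNat_lt_top
  refine measure_mono_null ?_ hlim
  rintro x ⟨N, hN, hxN⟩
  refine ((hAC ⟨N, hN⟩ x hxN).and_eventually (hAS _ ⟨⟨N, hN⟩, rfl⟩)).mono ?_
  rintro k ⟨hxk, hk⟩
  refine Set.mem_biUnion (x := r (C ⟨N, hN⟩ k)) (Finset.mem_coe.2 (Finset.mem_filter.2 ⟨hk, ?_⟩)) ?_
  · rw [hr]; exact hC ⟨N, hN⟩ k
  · rw [hr]; exact hxk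

/-! ### A family of independent clopen sets -/

/-- Independent clopen sets `independentSet n j` of measure `2 ^ (-n)`. -/
def independentSet (n j : ℕ) : Set (ℕ → Bool) :=
  {x | ∀ i < n, x (Nat.pair (Nat.pair n j) i) = true}

theorem isClopen_independentSet (n j : ℕ) : IsClopen (independentSet n j) := by
  have : independentSet n j =
      ⋂ i ∈ Finset.range n, (fun x : ℕ → Bool => x (Nat.pair (Nat.pair n j) i)) ⁻¹' {true} := by
    ext x
    simp [independentSet]
  rw [this]
  exact isClopen_biInter_finset fun i _ => (isClopen_discrete _).preimage (continuous_apply _)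

theorem cantorMeasure_pi_singleton (s : Finset ℕ) (x : ℕ → Bool) :
    cantorMeasure ((s : Set ℕ).pi fun i => {x i}) = 2⁻¹ ^ s.card := by
  rw [cantorMeasure, Measure.infinitePi_pi _ fun _ _ => measurableSet_singleton _]
  simp

/-- Injectivity of pairing gives distinct sets disjoint blocks of coordinates, so the intersection
prescribes exactly `∑ p ∈ T, p.1` coordinates. -/
theorem measure_biInter_independentSet (T : Finset (ℕ × ℕ)) :
    cantorMeasure (⋂ p ∈ T, independentSet p.1 p.2) = ∏ p ∈ T, 2⁻¹ ^ p.1 := by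
  classical
  have hset : (⋂ p ∈ T, independentSet p.1 p.2) =
      (((T.sigma fun p => Finset.range p.1).image fun q =>
        Nat.pair (Nat.pair q.1.1 q.1.2) q.2 : Finset ℕ) : Set ℕ).pi fun _ => {true} := by
    ext x
    simp only [independentSet, Set.mem_iInter, Set.mem_pi, Finset.mem_coe, Finset.mem_image,
      Finset.mem_sigma, Finset.mem_range, Set.mem_singleton_iff, Set.mem_ofPred_eq]
    constructor
    · rintro h _ ⟨q, ⟨hq, hi⟩, rfl⟩
      exact h _ hq _ hi
    · intro h p hp i hi
      exact h _ ⟨⟨p, i⟩, ⟨hp, hi⟩, rfl⟩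
  rw [hset, cantorMeasure_pi_singleton _ fun _ => true, Finset.card_image_of_injOn,
    Finset.card_sigma, Finset.prod_pow_eq_pow_sum]
  · simp
  · rintro ⟨⟨a, b⟩, c⟩ - ⟨⟨a', b'⟩, c'⟩ - h
    simp only [Nat.pair_eq_pair] at h
    obtain ⟨⟨rfl, rfl⟩, rfl⟩ := h
    rfl

theorem measure_independentSet (n j : ℕ) : cantorMeasure (independentSet n j) = 2⁻¹ ^ n := by
  simpa using measure_biInter_independentSet {(n, j)}

theorem iIndepSet_independentSet :
    iIndepSet (fun p : ℕ × ℕ => independentSet p.1 p.2) cantorMeasure := by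
  refine (iIndepSet_iff_meas_biInter fun p : ℕ × ℕ =>
    (isClopen_independentSet p.1 p.2).isOpen.measurableSet).2 fun T => ?_
  simp only [measure_biInter_independentSet, measure_independentSet]

theorem measure_biInter_compl_independentSet (T : Finset (ℕ × ℕ)) :
    cantorMeasure (⋂ p ∈ T, (independentSet p.1 p.2)ᶜ) = ∏ p ∈ T, (1 - 2⁻¹ ^ p.1) := by
  rw [iIndepSet_independentSet.iIndep_comap_mem.meas_biInter]
  · refine Finset.prod_congr rfl fun p _ => ?_
    rw [prob_compl_eq_one_sub (isClopen_independentSet p.1 p.2).isOpen.measurableSet,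
      measure_independentSet]
  · exact fun p _ => ⟨{False}, trivial, by ext x; simp⟩

/-- Avoiding `2 ^ n` independent sets of measure `2⁻¹ ^ n` thus costs at least half the measure. -/
theorem one_sub_inv_two_pow_pow_le (n : ℕ) : (1 - 2⁻¹ ^ n : ℝ≥0∞) ^ 2 ^ n ≤ 2⁻¹ := by
  have hreal : (1 - (2⁻¹ : ℝ) ^ n) ^ 2 ^ n ≤ 2⁻¹ := by
    have h0 : (0 : ℝ) ≤ 1 - 2⁻¹ ^ n := sub_nonneg.2 (pow_le_one₀ (by norm_num) (by norm_num))
    calc (1 - (2⁻¹ : ℝ) ^ n) ^ 2 ^ n ≤ Real.exp (-2⁻¹ ^ n) ^ 2 ^ n :=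
          pow_le_pow_left₀ h0 (Real.one_sub_le_exp_neg _) _
      _ = (Real.exp 1)⁻¹ := by
          rw [← Real.exp_nat_mul, ← Real.exp_neg]
          congr 1
          push_cast
          rw [mul_neg, ← mul_pow, mul_inv_cancel₀ two_ne_zero, one_pow]
      _ ≤ 2⁻¹ := by
          gcongr
          linarith [Real.add_one_le_exp (1 : ℝ)]
  have hcast : (1 - 2⁻¹ ^ n : ℝ≥0∞) = ENNReal.ofReal (1 - 2⁻¹ ^ n) := by
    rw [ENNReal.ofReal_sub _ (by positivity), ENNReal.ofReal_one,
      ENNReal.ofReal_pow (by norm_num), ENNReal.ofReal_inv_of_pos two_pos, ENNReal.ofReal_ofNat]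
  rw [hcast, ← ENNReal.ofReal_pow (sub_nonneg.2 (pow_le_one₀ (by norm_num) (by norm_num)))]
  refine (ENNReal.ofReal_le_ofReal hreal).trans_eq ?_
  rw [ENNReal.ofReal_inv_of_pos two_pos, ENNReal.ofReal_ofNat]

/-- If `K` is not null, then for almost all `n` at most `2 ^ n` of the sets
`independentSet n j` are disjoint from `K`. -/
theorem eventually_exists_finset_of_disjoint {K : Set (ℕ → Bool)} (hK : cantorMeasure K ≠ 0) :
    ∀ᶠ n in atTop, ∃ V : Finset ℕ, V.card ≤ 2 ^ n ∧
      ∀ j, Disjoint K (independentSet n j) → j ∈ V := by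
  classical
  by_contra hfreq
  have hinf := Nat.frequently_atTop_iff_infinite.1 (not_eventually.1 hfreq)
  have hJ : ∀ n, ∃ t : Finset ℕ, (¬ ∃ V : Finset ℕ, V.card ≤ 2 ^ n ∧
      ∀ j, Disjoint K (independentSet n j) → j ∈ V) →
        t.card = 2 ^ n ∧ ∀ j ∈ t, Disjoint K (independentSet n j) := by
    intro n
    by_cases hfin : {j | Disjoint K (independentSet n j)}.Finite
    · by_cases hc : hfin.toFinset.card ≤ 2 ^ n
      · exact ⟨∅, fun h => (h ⟨hfin.toFinset, hc, fun j hj => hfin.mem_toFinset.2 hj⟩).elim⟩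
      · obtain ⟨t, ht, htc⟩ := Finset.exists_subset_card_eq (not_le.1 hc).le
        exact ⟨t, fun _ => ⟨htc, fun j hj => hfin.mem_toFinset.1 (ht hj)⟩⟩
    · obtain ⟨t, ht, htc⟩ := Set.Infinite.exists_subset_card_eq hfin (2 ^ n)
      exact ⟨t, fun _ => ⟨htc, fun j hj => ht hj⟩⟩
  choose t ht using hJ
  -- Each bad level `n` supplies `2 ^ n` independent sets missed by `K`; distinct levels are
  -- independent, so `k` bad levels give `k` factors of at most `2⁻¹`.
  have hle : ∀ k : ℕ, cantorMeasure K ≤ 2⁻¹ ^ k := by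
    intro k
    obtain ⟨B, hB, hBc⟩ := hinf.exists_subset_card_eq k
    have hsub : K ⊆ ⋂ p ∈ (B.sigma t).map (Equiv.sigmaEquivProd ℕ ℕ).toEmbedding,
        (independentSet p.1 p.2)ᶜ := by
      intro x hx
      simp only [Set.mem_iInter, Finset.mem_map, Finset.mem_sigma]
      rintro _ ⟨q, ⟨hq, hqt⟩, rfl⟩
      exact Set.disjoint_left.1 ((ht _ (hB hq)).2 _ hqt) hx
    calc cantorMeasure K ≤ _ := measure_mono hsub
      _ = ∏ n ∈ B, (1 - 2⁻¹ ^ n : ℝ≥0∞) ^ 2 ^ n := by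
          rw [measure_biInter_compl_independentSet, Finset.prod_map, Finset.prod_sigma]
          refine Finset.prod_congr rfl fun n hn => ?_
          simp only [Equiv.coe_toEmbedding, Equiv.sigmaEquivProd_apply, Finset.prod_const]
          rw [(ht n (hB hn)).1]
      _ ≤ ∏ _n ∈ B, (2⁻¹ : ℝ≥0∞) := Finset.prod_le_prod' fun n _ => one_sub_inv_two_pow_pow_le n
      _ = 2⁻¹ ^ k := by rw [Finset.prod_const, hBc]
  exact hK (eq_zero_of_forall_le_inv_two_pow hle)

/-! ### Localization below the additivity of the null ideal -/

/-- The null set of all points that are in infinitely many of the sets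
`independentSet n (f n)`. -/
def hittingSet (f : ℕ → ℕ) : Set (ℕ → Bool) := {x | ∃ᶠ n in atTop, x ∈ independentSet n (f n)}

theorem hittingSet_mem_nullIdeal (f : ℕ → ℕ) : hittingSet f ∈ nullIdeal := by
  refine measure_setOfPred_frequently_eq_zero (p := fun n x => x ∈ independentSet n (f n)) ?_
  simp only [Set.ofPred_mem_eq, measure_independentSet]
  rw [ENNReal.tsum_geometric, ENNReal.one_sub_inv_two, inv_inv]
  exact ENNReal.ofNat_ne_top

/-- Outside a null set there is a compact set with no nonempty relatively open null subset. -/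
theorem exists_isCompact_of_null {N : Set (ℕ → Bool)} (hN : cantorMeasure N = 0) :
    ∃ K : Set (ℕ → Bool), IsCompact K ∧ K.Nonempty ∧ Disjoint K N ∧
      ∀ s : Clopens (ℕ → Bool), (K ∩ s).Nonempty → cantorMeasure (K ∩ s) ≠ 0 := by
  have hpos : 0 < cantorMeasure (toMeasurable cantorMeasure N)ᶜ := by
    rw [prob_compl_eq_one_sub (measurableSet_toMeasurable _ _), measure_toMeasurable, hN]
    simp
  obtain ⟨K, hKN, hK, hKpos⟩ := (measurableSet_toMeasurable _ _).compl.exists_lt_isCompact hpos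
  -- `W` collects the clopen sets that meet `K` in a null set. There are countably many, so removing
  -- `W` from `K` changes no measure.
  let W : Set (ℕ → Bool) := ⋃ s ∈ {s : Clopens (ℕ → Bool) | cantorMeasure (K ∩ s) = 0}, s
  have hW : IsOpen W := isOpen_biUnion fun s _ => s.isClopen.isOpen
  have hKW : cantorMeasure (K ∩ W) = 0 := by
    simp only [W, Set.inter_iUnion]
    exact (measure_biUnion_null_iff (Set.to_countable _)).2 fun s hs => hs
  have hdiff : ∀ s : Set (ℕ → Bool), cantorMeasure (K \ W ∩ s) = cantorMeasure (K ∩ s) := by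
    intro s
    refine le_antisymm (measure_mono (Set.inter_subset_inter_left _ Set.sdiff_subset)) ?_
    have hsub : K ∩ s ⊆ (K \ W ∩ s) ∪ (K ∩ W) := by
      rintro x ⟨hx, hxs⟩
      by_cases hxW : x ∈ W
      · exact Or.inr ⟨hx, hxW⟩
      · exact Or.inl ⟨⟨hx, hxW⟩, hxs⟩
    refine (measure_mono hsub).trans ((measure_union_le _ _).trans_eq ?_)
    rw [hKW, add_zero]
  refine ⟨K \ W, hK.diff hW, nonempty_of_measure_ne_zero (μ := cantorMeasure) ?_, ?_, ?_⟩
  · have := hdiff Set.univ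
    rw [Set.inter_univ, Set.inter_univ] at this
    exact this ▸ hKpos.ne'
  · exact Set.disjoint_left.2 fun x hx hxN => hKN hx.1 (subset_toMeasurable _ _ hxN)
  · rintro s ⟨x, ⟨hxK, hxW⟩, hxs⟩ h0
    exact hxW (Set.mem_biUnion (x := s) ((hdiff s).symm.trans h0) hxs)

/-- A compact set disjoint from `hittingSet f` has a nonempty clopen piece that is disjoint from
almost all sets `independentSet n (f n)`. -/
theorem exists_clopens_disjoint_independentSet {K : Set (ℕ → Bool)} (hK : IsCompact K)
    (hne : K.Nonempty) {f : ℕ → ℕ} (hf : Disjoint K (hittingSet f)) :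
    ∃ s : Clopens (ℕ → Bool), (K ∩ s).Nonempty ∧
      ∀ᶠ n in atTop, Disjoint (K ∩ s) (independentSet n (f n)) := by
  have : CompactSpace K := isCompact_iff_compactSpace.1 hK
  have : Nonempty K := hne.to_subtype
  -- Every point of `K` is in some closed `Z m`, so by Baire some `Z m` has interior in `K`.
  let Z : ℕ → Set K := fun m => ⋂ n ≥ m, (Subtype.val ⁻¹' (independentSet n (f n)))ᶜ
  have hZ : ∀ m, IsClosed (Z m) := fun m => isClosed_biInter fun n _ =>
    ((isClopen_independentSet n (f n)).preimage continuous_subtype_val).isOpen.isClosed_compl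
  have hU : ⋃ m, Z m = Set.univ := by
    refine Set.eq_univ_of_forall fun x => ?_
    obtain ⟨m, hm⟩ := eventually_atTop.1
      (not_frequently.1 (Set.disjoint_left.1 hf x.2))
    exact Set.mem_iUnion.2 ⟨m, Set.mem_iInter₂.2 hm⟩
  obtain ⟨m, x, hx⟩ := nonempty_interior_of_iUnion_of_closed hZ hU
  obtain ⟨O, hO, hOeq⟩ := isOpen_induced_iff.1 (isOpen_interior (s := Z m))
  have hxO : (x : ℕ → Bool) ∈ O := by
    rw [← hOeq] at hx
    exact hx
  obtain ⟨V, hV, hxV, hVO⟩ := isTopologicalBasis_isClopen.exists_subset_of_mem_open hxO hO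
  refine ⟨⟨V, hV⟩, ⟨x, x.2, hxV⟩, eventually_atTop.2 ⟨m, fun n hn => ?_⟩⟩
  refine Set.disjoint_left.2 ?_
  rintro y ⟨hyK, hyV⟩
  have hy : (⟨y, hyK⟩ : K) ∈ interior (Z m) := hOeq ▸ hVO hyV
  exact Set.mem_iInter₂.1 (interior_subset hy) n hn

/-- The compact `K` misses every `hittingSet f`, so each `f` has a clopen piece of `K` that misses
`independentSet n (f n)` for almost all `n`. The piece is not null, which leaves at most `2 ^ n`
candidates for `f n`; there are only countably many pieces. -/
theorem localized_of_lt_additivity {F : Set (ℕ → ℕ)} (hF : #F < additivity nullIdeal) :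
    Localized F := by
  classical
  have hnull : ⋃₀ (hittingSet '' F) ∈ nullIdeal :=
    sUnion_mem_of_lt_additivity (Set.image_subset_iff.2 fun f _ => hittingSet_mem_nullIdeal f)
      (mk_image_le.trans_lt hF)
  obtain ⟨K, hK, hne, hKN, hKs⟩ := exists_isCompact_of_null hnull
  obtain ⟨e, he⟩ := exists_surjective_nat (Clopens (ℕ → Bool))
  -- Where no set of `2 ^ n` candidates suffices, `V` is empty, so that the cardinality bound holds
  -- for all `m` and `n`.
  have hV : ∀ m n, ∃ V : Finset ℕ, V.card ≤ 2 ^ n ∧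
      ((∃ V' : Finset ℕ, V'.card ≤ 2 ^ n ∧
        ∀ j, Disjoint (K ∩ e m) (independentSet n j) → j ∈ V') →
          ∀ j, Disjoint (K ∩ e m) (independentSet n j) → j ∈ V) := by
    intro m n
    by_cases h : ∃ V' : Finset ℕ, V'.card ≤ 2 ^ n ∧
        ∀ j, Disjoint (K ∩ e m) (independentSet n j) → j ∈ V'
    · obtain ⟨V, hV, hjV⟩ := h
      exact ⟨V, hV, fun _ => hjV⟩
    · exact ⟨∅, by simp, fun h' => absurd h' h⟩
  choose V hV hjV using hV
  refine localized_of_countable_cover (fun m => {f | (K ∩ e m).Nonempty ∧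
    ∀ᶠ n in atTop, Disjoint (K ∩ e m) (independentSet n (f n))}) (fun f hf => ?_) V hV ?_
  · obtain ⟨s, hs⟩ := exists_clopens_disjoint_independentSet hK hne
      (hKN.mono_right (Set.subset_sUnion_of_mem (Set.mem_image_of_mem hittingSet hf)))
    obtain ⟨m, rfl⟩ := he s
    exact Set.mem_iUnion.2 ⟨m, hs⟩
  · rintro m f - ⟨hm, hfm⟩
    filter_upwards [hfm, eventually_exists_finset_of_disjoint (hKs _ hm)] with n hn hex
    exact hjV m n hex _ hn

/-! ### Null singletons and the equality of the cardinals. -/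

theorem cantorMeasure_singleton (x : ℕ → Bool) : cantorMeasure {x} = 0 := by
  have hle : ∀ n : ℕ, cantorMeasure {x} ≤ 2⁻¹ ^ n := fun n => by
    rw [← Finset.card_range n, ← cantorMeasure_pi_singleton _ x]
    exact measure_mono fun y hy i _ => congrFun hy i
  exact eq_zero_of_forall_le_inv_two_pow hle

theorem additivity_witnesses_nonempty :
    {κ | ∃ A : Set (Set (ℕ → Bool)), A ⊆ nullIdeal ∧ ⋃₀ A ∉ nullIdeal ∧ #A = κ}.Nonempty := by
  refine ⟨_, Set.range fun x : ℕ → Bool => {x}, ?_, ?_, rfl⟩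
  · rintro _ ⟨x, rfl⟩
    exact cantorMeasure_singleton x
  · have : ⋃₀ Set.range (fun x : ℕ → Bool => ({x} : Set (ℕ → Bool))) = Set.univ := by
      rw [Set.sUnion_range, Set.iUnion_of_singleton]
    rw [this]
    simp [nullIdeal]

theorem additivity_nullIdeal :
    additivity nullIdeal = min (uniformity raisonnierIdeal) boundingNumber := by
  apply le_antisymm
  · refine le_min (le_csInf uniformity_witnesses_nonempty ?_)
      (le_csInf boundingNumber_witnesses_nonempty ?_)
    · rintro _ ⟨X, hX, rfl⟩
      by_contra h
      exact hX (mem_raisonnierIdeal_of_localized fun N =>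
        localized_of_lt_additivity (mk_image_le.trans_lt (not_le.1 h)))
    · rintro _ ⟨F, hF, rfl⟩
      by_contra h
      exact hF (localized_of_lt_additivity (not_le.1 h)).exists_bound
  · refine le_csInf additivity_witnesses_nonempty ?_
    rintro _ ⟨A, hA, hU, rfl⟩
    by_contra h
    exact hU (measure_sUnion_eq_zero_of_localized hA fun F hF =>
      localized_of_lt_min (hF.trans_lt (not_le.1 h)))

end Raisonnier

theorem theorem6p5 :
    Raisonnier.additivity Raisonnier.nullIdeal =
      min (Raisonnier.uniformity Raisonnier.raisonnierIdeal) Raisonnier.boundingNumber := by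
  exact Raisonnier.additivity_nullIdeal
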